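/- Setting. Let $\Omega=(a,b)\subset\mathbb R$ with $-\infty<a<b<\infty$, and let $\bar\sigma\in(0,\infty)$. Assume the following. 1. $\hat f,Q\in C^0([0,1],[0,\infty))$, $\hat f(1)=1$, $\hat f^{-1}(\{0\})=Q^{-1}(\{0\})=\{0\}$, and both $Q$ and the function $f(t):=\big(\hat f(t)/Q(1-t)\big)^{1/2}$, $t\in[0,1)$, are non-decreasing in a right neighbourhood of $0$. 2. $\omega\in C^0([0,1],[0,\infty))$, $\omega^{-1}(\{0\})=\{0\}$, and $\lim_{t\to0^+}\big(\omega(t)/Q(t)\big)^{1/2}=\bar\sigma$. 3. $\varphi:[0,\infty)\to[0,\infty)$ is continuous and non-decreasing, with $\varphi(\infty):=\lim_{t\to\infty}\varphi(t)\in(0,\infty)$. 4. $\varphi^{-1}(\{0\})=\{0\}$, and $\varphi$ is right-differentiable at $0$ with $\varphi'(0^+)\in(0,\infty)$. For $\varepsilon>0$ and $u,v\in L^1(\Omega)$ set $$F_\varepsilon(u,v):=\int_\Omega\Big(\varphi\big(\varepsilon f^2(v)\big)|u'|^2+\frac{\omega(1-v)}{4\varepsilon}+\varepsilon|v'|^2\Big)\,dx$$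 if $u,v\in H^1(\Omega)$ and $v\in[0,1]$ a.e. in $\Omega$, and $F_\varepsilon(u,v):=\infty$ otherwise; here $\varphi(\varepsilon f^2(t))$ is given the value $\varphi(\infty)$ at $t=1$. A measurable function $u:\Omega\to\mathbb R$ belongs to $GBV(\Omega)$ if its truncation $u^M:=\max\{\min\{u,M\},-M\}$ belongs to $BV(\Omega)$ for every $M>0$. Theorem. Let $(u_\varepsilon,v_\varepsilon)_{\varepsilon>0}$ be a family in $L^1(\Omega)\times L^1(\Omega)$ with $$\sup_{\varepsilon>0}\big(F_\varepsilon(u_\varepsilon,v_\varepsilon)+\|u_\varepsilon\|_{L^1(\Omega)}\big)<\infty.$$ Then every sequence of positive numbers converging to $0$ has a subsequence $(\varepsilon_k)_k$ for which there is $u\in L^1(\Omega)\cap GBV(\Omega)$ such that $u_{\varepsilon_k}\to u$ and $v_{\varepsilon_k}\to1$ a.e. in $\Omega$. If, moreover, the family $(u_\varepsilon)_{\varepsilon>0}$ is equi-integrable, then $u_{\varepsilon_k}\to u$ in $L^1(\Omega)$. -/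

import Mathlib

open Set Filter Topology MeasureTheory
open scoped ENNReal

noncomputable section

namespace PhaseField

/-- `ψ ∈ C_c^n(Ω)`: a test function of class `C^n` on `ℝ` with compact support contained in `Ω`. -/
def IsTest (n : ℕ∞) (Ω : Set ℝ) (ψ : ℝ → ℝ) : Prop :=
  ContDiff ℝ n ψ ∧ HasCompactSupport ψ ∧ tsupport ψ ⊆ Ω

/-- `w` is a weak (distributional) derivative of `u` on the open set `Ω`; both are locally
integrable on `Ω`. -/
def IsWeakDeriv (Ω : Set ℝ) (u w : ℝ → ℝ) : Prop :=
  LocallyIntegrableOn u Ω ∧ LocallyIntegrableOn w Ω ∧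
    ∀ ψ : ℝ → ℝ, IsTest ⊤ Ω ψ → ∫ x in Ω, u x * deriv ψ x = -∫ x in Ω, w x * ψ x

open Classical in
/-- The weak derivative of `u` on `Ω` (unique up to null sets), and `0` if there is none. -/
def weakDeriv (Ω : Set ℝ) (u : ℝ → ℝ) : ℝ → ℝ :=
  if h : ∃ w, IsWeakDeriv Ω u w then h.choose else 0

/-- `u ∈ H¹(Ω)`: `u ∈ L²(Ω)` and `u` has a weak derivative on `Ω` that belongs to `L²(Ω)`. -/
def MemH1 (Ω : Set ℝ) (u : ℝ → ℝ) : Prop :=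
  MemLp u 2 (volume.restrict Ω) ∧
    ∃ w, IsWeakDeriv Ω u w ∧ MemLp w 2 (volume.restrict Ω)

/-- `u ∈ BV(Ω)`: `u ∈ L¹(Ω)` and the variation
`sup {∫_Ω u ψ' dx : ψ ∈ C_c^1(Ω), |ψ| ≤ 1}` is finite. -/
def MemBV (Ω : Set ℝ) (u : ℝ → ℝ) : Prop :=
  IntegrableOn u Ω ∧
    BddAbove {r : ℝ | ∃ ψ : ℝ → ℝ, IsTest 1 Ω ψ ∧ (∀ x, |ψ x| ≤ 1) ∧
      r = ∫ x in Ω, u x * deriv ψ x}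

/-- The truncation `u^M = max (min u M) (-M)` of `u` at the levels `±M`. -/
def trunc (M : ℝ) (u : ℝ → ℝ) : ℝ → ℝ := fun x => max (min (u x) M) (-M)

/-- `u ∈ GBV(Ω)` (for bounded `Ω`): `u` is measurable and all its truncations are in `BV(Ω)`,
which implies that they are in `BV_loc(Ω)`. -/
def MemGBV (Ω : Set ℝ) (u : ℝ → ℝ) : Prop :=
  AEStronglyMeasurable u (volume.restrict Ω) ∧ ∀ M : ℝ, 0 < M → MemBV Ω (trunc M u)

/-- `f(t) = (f̂(t) / Q(1 - t))^{1/2}`, of interest for `t ∈ [0, 1)`. -/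
def degr (fhat Q : ℝ → ℝ) (t : ℝ) : ℝ := √(fhat t / Q (1 - t))

/-- Hypotheses on `f`: `f̂, Q ∈ C⁰([0,1], [0,∞))`, `f̂(1) = 1`, `f̂` and `Q` vanish exactly at `0`,
and `Q` and `f` are non-decreasing in a right neighbourhood of the origin. -/
structure DegradationHyp (fhat Q : ℝ → ℝ) : Prop where
  fhat_cont : ContinuousOn fhat (Icc 0 1)
  Q_cont : ContinuousOn Q (Icc 0 1)
  fhat_nonneg : ∀ t ∈ Icc (0 : ℝ) 1, 0 ≤ fhat t
  Q_nonneg : ∀ t ∈ Icc (0 : ℝ) 1, 0 ≤ Q t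
  fhat_one : fhat 1 = 1
  fhat_zero_iff : ∀ t ∈ Icc (0 : ℝ) 1, fhat t = 0 ↔ t = 0
  Q_zero_iff : ∀ t ∈ Icc (0 : ℝ) 1, Q t = 0 ↔ t = 0
  Q_mono : ∃ δ ∈ Ioo (0 : ℝ) 1, MonotoneOn Q (Ico 0 δ)
  degr_mono : ∃ δ ∈ Ioo (0 : ℝ) 1, MonotoneOn (degr fhat Q) (Ico 0 δ)

/-- Hypotheses on the damage potential, with a finite limit `σ`: `pot ∈ C⁰([0,1], [0,∞))` vanishes exactly at `0`, and
`(pot(t) / Q(t))^{1/2} → σ` as `t → 0⁺`. -/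
structure PotentialHyp (pot Q : ℝ → ℝ) (σ : ℝ) : Prop where
  cont : ContinuousOn pot (Icc 0 1)
  nonneg : ∀ t ∈ Icc (0 : ℝ) 1, 0 ≤ pot t
  zero_iff : ∀ t ∈ Icc (0 : ℝ) 1, pot t = 0 ↔ t = 0
  tendsto : Tendsto (fun t => √(pot t / Q t)) (𝓝[>] 0) (𝓝 σ)

/-- First hypotheses on `φ`: `φ : [0,∞) → [0,∞)` is continuous and non-decreasing, and it has a limit
`φ(∞) ∈ (0,∞)` at infinity. -/
structure PhiHyp (φ : ℝ → ℝ) : Prop where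
  nonneg : ∀ t, 0 ≤ t → 0 ≤ φ t
  cont : ContinuousOn φ (Ici 0)
  mono : MonotoneOn φ (Ici 0)
  tendsto : ∃ L : ℝ, 0 < L ∧ Tendsto φ atTop (𝓝 L)

/-- Hypotheses on `φ` near `0`: `φ` vanishes exactly at `0` and has a right derivative `φ'(0⁺) ∈ (0,∞)` there. -/
structure PhiZeroHyp (φ : ℝ → ℝ) : Prop where
  zero_iff : ∀ t, 0 ≤ t → (φ t = 0 ↔ t = 0)
  deriv : ∃ d : ℝ, 0 < d ∧ HasDerivWithinAt φ d (Ici 0) 0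

/-- The function `t ↦ φ(ε f²(t))` on `[0,1)`, with the value `φ(∞)` at `t = 1`. -/
def coeff (φ fhat Q : ℝ → ℝ) (ε t : ℝ) : ℝ :=
  if t < 1 then φ (ε * degr fhat Q t ^ 2) else limUnder atTop φ

open Classical in
/-- The phase-field energy
`F_ε(u, v, A) = ∫_A (φ(ε f²(v)) |u'|² + pot(1 - v) / (4ε) + ε |v'|²) dx`
if `(u, v) ∈ H¹(Ω, ℝ × [0,1])`, and `∞` otherwise. -/
def energy (φ fhat Q pot : ℝ → ℝ) (Ω : Set ℝ) (ε : ℝ) (u v : ℝ → ℝ) (A : Set ℝ) : ℝ≥0∞ :=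
  if MemH1 Ω u ∧ MemH1 Ω v ∧ ∀ᵐ x ∂volume.restrict Ω, v x ∈ Icc (0 : ℝ) 1 then
    ∫⁻ x in A, ENNReal.ofReal
      (coeff φ fhat Q ε (v x) * |weakDeriv Ω u x| ^ 2 + pot (1 - v x) / (4 * ε)
        + ε * |weakDeriv Ω v x| ^ 2)
  else ∞

end PhaseField

end

/-! The integrand `D` of the phase-field energy controls two first-order quantities, uniformly in
`ε`. Where `v ≤ 1/2`, Young's inequality for the last two terms bounds `|v'|` by a multiple of `D`
(`exists_abs_le_mul_density_of_ge`). Where `v ≥ 1/4`, it bounds `|u'|` by a multiple of `D + 1`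
(`exists_abs_le_mul_density_of_le`): either `ε f²(v)` is at least `1`, so that the coefficient of
`|u'|²` is bounded below, or `φ(ε f²(v))` is at least a multiple of `ε f̂(v) / Q(1 - v)`, and Young's
inequality with `pot(1 - v) / (4ε) ≥ c Q(1 - v) / ε` makes `ε` and `Q` cancel.

Let `cutoff` vanish on `(-∞, 1/4]` and be constant on `[1/2, ∞)`. For every bounded `1`-Lipschitz
function `T`, the product `cutoff(v) T(u)` then has a derivative bounded by a multiple of `D + 1`, so
it is bounded in `W^{1,1}(a, b)` along the family
(`exists_integral_abs_deriv_cutoff_mul_le`). Since `v → 1` in measure, `cutoff(v) → 1/4` almost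
everywhere along a subsequence, and the cutoff can be divided out in the limit.

* With `T = arctan`, Helly's selection theorem (`exists_subseq_tendsto_of_integral_abs_deriv_le`)
  gives a subsequence along which `arctan u` converges almost everywhere. By Fatou's lemma and the
  bound in `L¹`, the values of `u` do not escape to infinity, so `u` itself converges almost
  everywhere.
* With `T` the truncation at level `M`, lower semicontinuity of the variation (`memBV_of_tendsto`)
  shows that the truncations of the limit are in `BV`.

Convergence in `L¹` for equi-integrable families is Vitali's theorem.

Absolutely continuous representatives of functions in `H¹(a, b)`, provided by the lemma of
du Bois-Reymond (`MemH1.exists_absolutelyContinuous`), give access to pointwise derivatives. -/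

noncomputable section

namespace PhaseField

/-! ### Absolutely continuous representatives -/

/-- A compact subset of an open interval lies in a smaller closed interval. -/
theorem exists_Icc_of_isCompact_subset_Ioo {a b : ℝ} (hab : a < b) {K : Set ℝ}
    (hK : IsCompact K) (hKs : K ⊆ Ioo a b) :
    ∃ c d, a < c ∧ c ≤ d ∧ d < b ∧ K ⊆ Icc c d := by
  rcases K.eq_empty_or_nonempty with rfl | hne
  · exact ⟨(a + b) / 2, (a + b) / 2, by linarith, le_rfl, by linarith, empty_subset _⟩
  · obtain ⟨c, hc⟩ := hK.exists_isLeast hne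
    obtain ⟨d, hd⟩ := hK.exists_isGreatest hne
    exact ⟨c, d, (hKs hc.1).1, hc.2 hd.1, (hKs hd.1).2, fun x hx => ⟨hc.2 hx, hd.2 hx⟩⟩

theorem IsTest.integrableOn_deriv_mul {a b : ℝ} {n : ℕ∞} (hn : 1 ≤ n) {ψ : ℝ → ℝ} {s : Set ℝ}
    (hψ : IsTest n s ψ) {g : ℝ → ℝ} (hg : IntegrableOn g (Ioo a b)) :
    IntegrableOn (fun x => g x * deriv ψ x) (Ioo a b) := by
  have hc : Continuous (deriv ψ) := hψ.1.continuous_deriv (by exact_mod_cast hn)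
  obtain ⟨C, hC⟩ := hψ.2.1.deriv.exists_bound_of_continuous hc
  exact Integrable.mul_bdd hg hc.aestronglyMeasurable (ae_of_all _ hC)

/-- A smooth test function of mean zero is the derivative of a test function. -/
theorem exists_isTest_deriv_eq {a b : ℝ} (hab : a < b) {h : ℝ → ℝ} (hh : IsTest ⊤ (Ioo a b) h)
    (h0 : ∫ x in Ioo a b, h x = 0) : ∃ ψ, IsTest ⊤ (Ioo a b) ψ ∧ deriv ψ = h := by
  obtain ⟨c, d, hac, hcd, hdb, hK⟩ := exists_Icc_of_isCompact_subset_Ioo hab hh.2.1 hh.2.2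
  have hcont : Continuous h := hh.1.continuous
  have hd : ∀ x, HasDerivAt (fun x => ∫ t in a..x, h t) (h x) x := fun x =>
    intervalIntegral.integral_hasDerivAt_right (hcont.intervalIntegrable _ _)
      (hcont.stronglyMeasurableAtFilter _ _) hcont.continuousAt
  have hder : deriv (fun x => ∫ t in a..x, h t) = h := funext fun x => (hd x).deriv
  have hz : ∀ x, x ∉ Icc c d → h x = 0 := fun x hx =>
    image_eq_zero_of_notMem_tsupport fun hx' => hx (hK hx')
  have hsupp : Function.support (fun x => ∫ t in a..x, h t) ⊆ Icc c d := by
    intro x hx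
    by_contra hxI
    apply hx
    rcases lt_or_ge x c with hxc | hxc
    · refine intervalIntegral.integral_zero_ae (ae_of_all _ fun t ht => hz t ?_)
      rintro ⟨h1, -⟩
      have := ht.2
      rcases le_total a x with h | h
      · rw [max_eq_right h] at this; linarith
      · rw [max_eq_left h] at this; linarith
    · have hxd : d < x := by
        by_contra h; exact hxI ⟨hxc, not_lt.1 h⟩
      have h1 : ∫ t in a..b, h t = 0 := by
        rw [intervalIntegral.integral_of_le hab.le, integral_Ioc_eq_integral_Ioo, h0]
      have h2 : ∫ t in x..b, h t = 0 := by
        refine intervalIntegral.integral_zero_ae (ae_of_all _ fun t ht => hz t ?_)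
        rintro ⟨-, h1⟩
        have := ht.1
        rcases le_total x b with h | h
        · rw [min_eq_left h] at this; linarith
        · rw [min_eq_right h] at this; linarith
      have h3 := intervalIntegral.integral_add_adjacent_intervals
        (hcont.intervalIntegrable a x) (hcont.intervalIntegrable x b) (μ := volume)
      simp only
      linarith
  have hts : tsupport (fun x => ∫ t in a..x, h t) ⊆ Icc c d :=
    closure_minimal hsupp isClosed_Icc
  refine ⟨fun x => ∫ t in a..x, h t, ⟨?_, ?_, ?_⟩, hder⟩
  · refine contDiff_infty_iff_deriv.2 ⟨fun x => (hd x).differentiableAt, ?_⟩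
    rw [hder]; exact hh.1
  · exact HasCompactSupport.of_support_subset_isCompact isCompact_Icc hsupp
  · exact hts.trans fun x hx => ⟨hac.trans_le hx.1, hx.2.trans_lt hdb⟩

/-- The lemma of du Bois-Reymond: a function with vanishing weak derivative is constant. -/
theorem ae_eq_const_of_integral_mul_deriv_eq_zero {a b : ℝ} (hab : a < b) {g : ℝ → ℝ}
    (hg : IntegrableOn g (Ioo a b))
    (h : ∀ ψ, IsTest ⊤ (Ioo a b) ψ → ∫ x in Ioo a b, g x * deriv ψ x = 0) :
    ∃ c : ℝ, ∀ᵐ x ∂volume.restrict (Ioo a b), g x = c := by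
  let ρ : ContDiffBump ((a + b) / 2) := ⟨(b - a) / 8, (b - a) / 4, by linarith, by linarith⟩
  have hρt : IsTest ⊤ (Ioo a b) (ρ.normed volume) := by
    refine ⟨ρ.contDiff_normed, ρ.hasCompactSupport_normed, ?_⟩
    rw [ρ.tsupport_normed_eq]
    intro x hx
    have hx' : dist x ((a + b) / 2) ≤ (b - a) / 4 := hx
    rw [Real.dist_eq, abs_le] at hx'
    exact ⟨by linarith, by linarith⟩
  have setInt : ∀ f : ℝ → ℝ, tsupport f ⊆ Ioo a b → ∫ x in Ioo a b, f x = ∫ x, f x :=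
    fun f hf => setIntegral_eq_integral_of_forall_compl_eq_zero fun x hx =>
      image_eq_zero_of_notMem_tsupport fun h => hx (hf h)
  have hρ1 : ∫ x in Ioo a b, ρ.normed volume x = 1 := by
    rw [setInt _ hρt.2.2, ρ.integral_normed]
  -- For a test function `f`, `f - (∫ f) r` has mean zero, hence is the derivative of a test
  -- function.
  set r := ρ.normed volume with hr
  refine ⟨∫ x in Ioo a b, g x * r x, ?_⟩
  set c := ∫ x in Ioo a b, g x * r x with hc
  have mulInt : ∀ {f g : ℝ → ℝ}, IsTest ⊤ (Ioo a b) f → IntegrableOn g (Ioo a b) →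
      IntegrableOn (fun x => g x * f x) (Ioo a b) := by
    intro f g hf hg
    obtain ⟨C, hC⟩ := hf.2.1.exists_bound_of_continuous hf.1.continuous
    exact Integrable.mul_bdd hg hf.1.continuous.aestronglyMeasurable (ae_of_all _ hC)
  have hcI : IntegrableOn (fun _ : ℝ => c) (Ioo a b) := by simp
  have key := isOpen_Ioo.ae_eq_zero_of_integral_contDiff_smul_eq_zero
    (f := fun x => g x - c) (U := Ioo a b) (μ := volume)
    (hg.sub hcI).locallyIntegrableOn ?_
  · rw [ae_restrict_iff' measurableSet_Ioo]
    filter_upwards [key] with x hx hxI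
    exact sub_eq_zero.1 (hx hxI)
  · intro f hf1 hf2 hf3
    have hf : IsTest ⊤ (Ioo a b) f := ⟨hf1, hf2, hf3⟩
    rw [← setInt (fun x => f x • (g x - c)) ((tsupport_smul_subset_left _ _).trans hf3)]
    set m := ∫ x in Ioo a b, f x with hm
    have hfI : IntegrableOn f (Ioo a b) :=
      (hf1.continuous.integrable_of_hasCompactSupport hf2).integrableOn
    have hrI : IntegrableOn r (Ioo a b) :=
      (hρt.1.continuous.integrable_of_hasCompactSupport hρt.2.1).integrableOn
    have htest : IsTest ⊤ (Ioo a b) (fun x => f x - m * r x) := by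
      refine ⟨hf1.sub (contDiff_const.mul hρt.1), hf2.sub hρt.2.1.mul_left, ?_⟩
      refine (tsupport_sub _ _).trans (union_subset hf3 ?_)
      exact (tsupport_mul_subset_right).trans hρt.2.2
    obtain ⟨ψ, hψ, hψd⟩ := exists_isTest_deriv_eq hab htest (by
      rw [integral_sub hfI (hrI.const_mul m), integral_const_mul, hρ1]; simp [hm])
    have h1 := h ψ hψ
    rw [hψd] at h1
    have h2 : ∫ x in Ioo a b, g x * (f x - m * r x)
        = (∫ x in Ioo a b, g x * f x) - m * c := by
      rw [hc, ← integral_const_mul, ← integral_sub (mulInt hf hg) ((mulInt hρt hg).const_mul m)]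
      congr 1; ext x; ring
    have h3 : ∫ x in Ioo a b, f x • (g x - c) = (∫ x in Ioo a b, g x * f x) - m * c := by
      rw [hm, ← integral_mul_const, ← integral_sub (mulInt hf hg) (hfI.mul_const c)]
      congr 1; ext x; simp only [smul_eq_mul]; ring
    rw [h3, ← h2, h1]

/-- Integration by parts against a test function for absolutely continuous functions. -/
theorem integral_mul_deriv_test {a b : ℝ} (hab : a < b) {W ψ : ℝ → ℝ}
    (hW : AbsolutelyContinuousOnInterval W a b) (hψ : IsTest 1 (Ioo a b) ψ) :
    ∫ x in Ioo a b, W x * deriv ψ x = -∫ x in Ioo a b, deriv W x * ψ x := by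
  have hψ1 : ContDiff ℝ 1 ψ := by exact_mod_cast hψ.1
  have h := hW.integral_mul_deriv_eq_deriv_mul (hψ1.contDiffOn.absolutelyContinuousOnInterval)
  have ha : ψ a = 0 := image_eq_zero_of_notMem_tsupport fun h => (hψ.2.2 h).1.false
  have hb : ψ b = 0 := image_eq_zero_of_notMem_tsupport fun h => (hψ.2.2 h).2.false
  rw [ha, hb, intervalIntegral.integral_of_le hab.le, intervalIntegral.integral_of_le hab.le,
    integral_Ioc_eq_integral_Ioo, integral_Ioc_eq_integral_Ioo] at h
  linarith

theorem IsTest.of_top {Ω : Set ℝ} {ψ : ℝ → ℝ} (hψ : IsTest ⊤ Ω ψ) : IsTest 1 Ω ψ :=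
  ⟨hψ.1.of_le (by exact_mod_cast le_top), hψ.2⟩

theorem IsWeakDeriv.ae_eq {a b : ℝ} {u w₁ w₂ : ℝ → ℝ} (h₁ : IsWeakDeriv (Ioo a b) u w₁)
    (h₂ : IsWeakDeriv (Ioo a b) u w₂) : ∀ᵐ x ∂volume.restrict (Ioo a b), w₁ x = w₂ x := by
  have mulInt : ∀ {f w : ℝ → ℝ}, IsTest ⊤ (Ioo a b) f → LocallyIntegrableOn w (Ioo a b) →
      IntegrableOn (fun x => w x * f x) (Ioo a b) := by
    intro f w hf hw
    obtain ⟨C, hC⟩ := hf.2.1.exists_bound_of_continuous hf.1.continuous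
    have h1 : IntegrableOn (fun x => w x * f x) (tsupport f) :=
      Integrable.mul_bdd (hw.integrableOn_compact_subset hf.2.2 hf.2.1)
        hf.1.continuous.aestronglyMeasurable (ae_of_all _ hC)
    refine ((integrableOn_iff_integrable_of_support_subset ?_).1 h1).integrableOn
    exact (Function.support_mul_subset_right _ _).trans subset_closure
  have key := isOpen_Ioo.ae_eq_zero_of_integral_contDiff_smul_eq_zero
    (f := fun x => w₁ x - w₂ x) (U := Ioo a b) (μ := volume) (h₁.2.1.sub h₂.2.1) ?_
  · rw [ae_restrict_iff' measurableSet_Ioo]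
    filter_upwards [key] with x hx hxI
    exact sub_eq_zero.1 (hx hxI)
  · intro f hf1 hf2 hf3
    have hf : IsTest ⊤ (Ioo a b) f := ⟨hf1, hf2, hf3⟩
    rw [← setIntegral_eq_integral_of_forall_compl_eq_zero (s := Ioo a b) fun x hx => by
      rw [image_eq_zero_of_notMem_tsupport fun h => hx (hf3 h), zero_smul]]
    have e : ∀ x, f x • (w₁ x - w₂ x) = w₁ x * f x - w₂ x * f x := fun x => by
      simp only [smul_eq_mul]; ring
    simp_rw [e]
    rw [integral_sub (mulInt hf h₁.2.1) (mulInt hf h₂.2.1)]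
    have := h₁.2.2 f hf
    have := h₂.2.2 f hf
    linarith

/-- Functions in `H¹(a, b)` have an absolutely continuous representative on `[a, b]`, whose
pointwise derivative is the weak derivative. -/
theorem MemH1.exists_absolutelyContinuous {a b : ℝ} (hab : a < b) {u : ℝ → ℝ}
    (hu : MemH1 (Ioo a b) u) :
    ∃ U : ℝ → ℝ, AbsolutelyContinuousOnInterval U a b ∧
      (∀ᵐ x ∂volume.restrict (Ioo a b), u x = U x) ∧
      ∀ᵐ x ∂volume.restrict (Ioo a b), HasDerivAt U (weakDeriv (Ioo a b) u x) x := by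
  obtain ⟨hu2, w, hw, hw2⟩ := hu
  have hex : ∃ w, IsWeakDeriv (Ioo a b) u w := ⟨w, hw⟩
  have hwd : IsWeakDeriv (Ioo a b) u (weakDeriv (Ioo a b) u) := by
    rw [weakDeriv, dif_pos hex]; exact hex.choose_spec
  have huI : IntegrableOn u (Ioo a b) := hu2.integrable one_le_two
  have hwI : IntegrableOn w (Ioo a b) := hw2.integrable one_le_two
  have hwII : IntervalIntegrable w volume a b :=
    (intervalIntegrable_iff_integrableOn_Ioo_of_le hab.le).2 hwI
  have hAC := hwII.absolutelyContinuousOnInterval_intervalIntegral (c := a) left_mem_uIcc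
  have hWd : ∀ᵐ x ∂volume.restrict (Ioo a b),
      HasDerivAt (fun x => ∫ t in a..x, w t) (w x) x := by
    rw [ae_restrict_iff' measurableSet_Ioo]
    filter_upwards [hwII.ae_hasDerivAt_integral] with x hx hxI
    exact hx (Ioo_subset_Icc_self.trans (Icc_subset_uIcc) hxI) a left_mem_uIcc
  set W := fun x => ∫ t in a..x, w t with hWdef
  have hWI : IntegrableOn W (Ioo a b) := by
    have := hAC.continuousOn
    rw [uIcc_of_le hab.le] at this
    exact this.integrableOn_Icc.mono_set Ioo_subset_Icc_self
  obtain ⟨c, hc⟩ := ae_eq_const_of_integral_mul_deriv_eq_zero hab (g := fun x => u x - W x)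
    (huI.sub hWI) (by
      intro ψ hψ
      have h1 := integral_mul_deriv_test hab hAC hψ.of_top
      have h2 : ∫ x in Ioo a b, deriv W x * ψ x = ∫ x in Ioo a b, w x * ψ x :=
        integral_congr_ae (hWd.mono fun x hx => by simp only [hx.deriv])
      have h3 := hw.2.2 ψ hψ
      simp_rw [sub_mul]
      rw [integral_sub (hψ.integrableOn_deriv_mul le_top huI)
        (hψ.integrableOn_deriv_mul le_top hWI), h1, h2, h3, sub_self])
  refine ⟨fun x => W x + c, ?_, ?_, ?_⟩
  · exact hAC.fun_add
      (LipschitzOnWith.absolutelyContinuousOnInterval (LipschitzWith.const c).lipschitzOnWith)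
  · filter_upwards [hc] with x hx
    linarith
  · filter_upwards [hWd, hw.ae_eq hwd] with x hx hx'
    rw [← hx']
    exact hx.add_const c

/-! ### Helly's selection theorem -/

/-- Helly's selection theorem for monotone functions: a uniformly bounded sequence of monotone
functions has a subsequence that converges outside a null set (in fact a countable one). -/
theorem exists_subseq_tendsto_of_monotone {F : ℕ → ℝ → ℝ} {C : ℝ} (hF : ∀ n, Monotone (F n))
    (hC : ∀ n x, |F n x| ≤ C) :
    ∃ k : ℕ → ℕ, StrictMono k ∧
      ∀ᵐ x : ℝ, ∃ l, Tendsto (fun j => F (k j) x) atTop (𝓝 l) := by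
  have hcpt : IsCompact (univ.pi fun _ : ℚ => Icc (-C) C) := isCompact_univ_pi fun _ => isCompact_Icc
  obtain ⟨g, -, k, hk, hg⟩ := hcpt.tendsto_subseq (x := fun n (q : ℚ) => F n q)
    fun n q _ => abs_le.1 (hC n q)
  rw [tendsto_pi_nhds] at hg
  refine ⟨k, hk, ?_⟩
  have bA : ∀ x, IsBoundedUnder (· ≤ ·) atTop (fun j => F (k j) x) := fun x =>
    isBoundedUnder_of ⟨C, fun j => (abs_le.1 (hC _ _)).2⟩
  have bB : ∀ x, IsBoundedUnder (· ≥ ·) atTop (fun j => F (k j) x) := fun x =>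
    isBoundedUnder_of ⟨-C, fun j => (abs_le.1 (hC _ _)).1⟩
  set m : ℝ → ℝ := fun x => liminf (fun j => F (k j) x) atTop with hm
  have hmono : Monotone m := fun x y hxy =>
    liminf_le_liminf (Eventually.of_forall fun j => hF _ hxy) (bB x) (bA y).isCoboundedUnder_ge
  -- A rational point between `x` and `y`, where the sequence converges, links the two limits.
  have hlt : ∀ x y, x < y → limsup (fun j => F (k j) x) atTop ≤ m y := by
    intro x y hxy
    obtain ⟨q, hxq, hqy⟩ := exists_rat_btwn hxy
    have h1 : limsup (fun j => F (k j) x) atTop ≤ limsup (fun j => F (k j) q) atTop :=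
      limsup_le_limsup (Eventually.of_forall fun j => hF _ hxq.le)
        (bB x).isCoboundedUnder_le (bA q)
    have h2 : limsup (fun j => F (k j) q) atTop = m q :=
      (hg q).limsup_eq.trans (hg q).liminf_eq.symm
    exact (h1.trans_eq h2).trans (hmono hqy.le)
  filter_upwards [hmono.countable_not_continuousAt.ae_notMem volume] with x hx
  have hx : ContinuousAt m x := by simpa using hx
  refine ⟨m x, tendsto_of_le_liminf_of_limsup_le le_rfl ?_ (bA x) (bB x)⟩
  refine ge_of_tendsto (hx.tendsto.mono_left nhdsWithin_le_nhds : Tendsto m (𝓝[>] x) _) ?_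
  filter_upwards [self_mem_nhdsWithin] with y hy using hlt x y hy

/-- Helly's selection theorem for absolutely continuous functions that are bounded in `W^{1,1}`. -/
theorem exists_subseq_tendsto_of_integral_abs_deriv_le {a b M C : ℝ} (hab : a < b)
    {z : ℕ → ℝ → ℝ} (hz : ∀ n, AbsolutelyContinuousOnInterval (z n) a b)
    (hM : ∀ n x, |z n x| ≤ M) (hC : ∀ n, ∫ x in a..b, |deriv (z n) x| ≤ C) :
    ∃ k : ℕ → ℕ, StrictMono k ∧
      ∀ᵐ x ∂volume.restrict (Ioo a b), ∃ l, Tendsto (fun j => z (k j) x) atTop (𝓝 l) := by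
  have hI : ∀ n x y, a ≤ x → x ≤ b → a ≤ y → y ≤ b →
      IntervalIntegrable (deriv (z n)) volume x y := fun n x y hx hx' hy hy' =>
    (hz n).intervalIntegrable_deriv.mono_set
      (uIcc_subset_uIcc (Icc_subset_uIcc ⟨hx, hx'⟩) (Icc_subset_uIcc ⟨hy, hy'⟩))
  -- On `[a, b]`, `z n` is the difference of the monotone functions `P n`, the integral of
  -- `|(z n)'|`, and `P n - z n`; composition with the projection `π` onto `[a, b]` extends both to `ℝ`.
  let π : ℝ → ℝ := fun x => projIcc a b hab.le x
  have hπm : Monotone π := fun x y h => monotone_projIcc hab.le h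
  have hπ1 : ∀ x, a ≤ π x := fun x => (projIcc a b hab.le x).2.1
  have hπ2 : ∀ x, π x ≤ b := fun x => (projIcc a b hab.le x).2.2
  let P : ℕ → ℝ → ℝ := fun n x => ∫ t in a..π x, |deriv (z n) t|
  have hPd : ∀ n x y, P n y - P n x = ∫ t in π x..π y, |deriv (z n) t| := fun n x y =>
    intervalIntegral.integral_interval_sub_left
      (hI n _ _ le_rfl hab.le (hπ1 _) (hπ2 _)).abs (hI n _ _ le_rfl hab.le (hπ1 _) (hπ2 _)).abs
  have hP : ∀ n, Monotone (P n) := fun n x y hxy => by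
    rw [← sub_nonneg, hPd]
    exact intervalIntegral.integral_nonneg (hπm hxy) fun _ _ => abs_nonneg _
  have hPb : ∀ n x, |P n x| ≤ C := fun n x => by
    rw [abs_of_nonneg (intervalIntegral.integral_nonneg (hπ1 x) fun _ _ => abs_nonneg _)]
    refine le_trans ?_ (hC n)
    exact intervalIntegral.integral_mono_interval le_rfl (hπ1 x) (hπ2 x)
      (ae_of_all _ fun _ => abs_nonneg _) (hz n).intervalIntegrable_deriv.abs
  have hN : ∀ n, Monotone fun x => P n x - z n (π x) := fun n x y hxy => by
    have h1 := ((hz n).mono (c := π x) (d := π y) (uIcc_subset_uIcc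
      (Icc_subset_uIcc ⟨hπ1 _, hπ2 _⟩) (Icc_subset_uIcc ⟨hπ1 _, hπ2 _⟩))).integral_deriv_eq_sub
    have h2 := intervalIntegral.integral_mono_on (hπm hxy)
      (hI n _ _ (hπ1 x) (hπ2 x) (hπ1 y) (hπ2 y)) (hI n _ _ (hπ1 x) (hπ2 x) (hπ1 y) (hπ2 y)).abs
      fun t _ => le_abs_self _
    have h3 := hPd n x y
    simp only
    linarith
  obtain ⟨k₁, hk₁, h₁⟩ := exists_subseq_tendsto_of_monotone hP hPb
  obtain ⟨k₂, hk₂, h₂⟩ := exists_subseq_tendsto_of_monotone (C := C + M) (fun n => hN (k₁ n))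
    fun n x => (abs_sub _ _).trans (add_le_add (hPb _ _) (hM _ _))
  refine ⟨k₁ ∘ k₂, hk₁.comp hk₂, ?_⟩
  rw [ae_restrict_iff' measurableSet_Ioo]
  filter_upwards [h₁, h₂] with x ⟨l₁, hl₁⟩ ⟨l₂, hl₂⟩ hx
  refine ⟨l₁ - l₂, ((hl₁.comp hk₂.tendsto_atTop).sub hl₂).congr fun j => ?_⟩
  have : π x = x := by simp [π, projIcc_of_mem hab.le (Ioo_subset_Icc_self hx)]
  simp [this]

/-! ### Lower bounds for the energy density -/

theorem PhiHyp.exists_mul_min_le {φ : ℝ → ℝ} (h3 : PhiHyp φ) (h4 : PhiZeroHyp φ) :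
    ∃ c > 0, ∀ t, 0 ≤ t → c * min t 1 ≤ φ t := by
  obtain ⟨d, hd, hderiv⟩ := h4.deriv
  have h0 : φ 0 = 0 := (h4.zero_iff 0 le_rfl).2 rfl
  have hpos : ∀ t, 0 < t → 0 < φ t := fun t ht =>
    (h3.nonneg t ht.le).lt_of_ne fun h => ht.ne' ((h4.zero_iff t ht.le).1 h.symm)
  have hs : Tendsto (slope φ 0) (𝓝[>] 0) (𝓝 d) := by
    have := hasDerivWithinAt_iff_tendsto_slope.1 hderiv
    rwa [Ici_sdiff_left] at this
  obtain ⟨δ, hδ, hδ'⟩ := mem_nhdsGT_iff_exists_Ioo_subset.1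
    (hs.eventually (lt_mem_nhds (half_lt_self hd)))
  have hδ : 0 < δ := hδ
  -- The derivative gives `φ t ≥ (d / 2) t` for `t < δ`, and monotonicity `φ t ≥ φ (δ / 2)` beyond.
  refine ⟨min (d / 2) (φ (δ / 2)), lt_min (by linarith) (hpos _ (by linarith)), fun t ht => ?_⟩
  rcases ht.eq_or_lt with rfl | ht
  · simp [h0]
  have hm1 : 0 ≤ min t 1 := le_min ht.le zero_le_one
  rcases lt_or_ge t δ with h | h
  · have := hδ' ⟨ht, h⟩
    simp only [mem_ofPred_eq, slope_def_field, h0, sub_zero] at this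
    rw [lt_div_iff₀ ht] at this
    calc _ ≤ d / 2 * t := mul_le_mul (min_le_left _ _) (min_le_left _ _) hm1 (by linarith)
      _ ≤ _ := this.le
  · calc _ ≤ φ (δ / 2) * 1 := mul_le_mul (min_le_right _ _) (min_le_right _ _) hm1
          (h3.nonneg _ (by linarith))
      _ ≤ φ t := by
          rw [mul_one]
          exact h3.mono (mem_Ici.2 (by linarith)) (mem_Ici.2 ht.le) (by linarith)

theorem exists_pos_le_of_continuousOn {f : ℝ → ℝ} {s t : ℝ}
    (hf : ContinuousOn f (Icc s t)) (hpos : ∀ x ∈ Icc s t, 0 < f x) :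
    ∃ m > 0, ∀ x ∈ Icc s t, m ≤ f x := by
  rcases (Icc s t).eq_empty_or_nonempty with h | h
  · exact ⟨1, one_pos, by simp [h]⟩
  · obtain ⟨x, hx, hmin⟩ := isCompact_Icc.exists_isMinOn h hf
    exact ⟨f x, hpos x hx, fun y hy => hmin hy⟩

theorem PotentialHyp.pos {pot Q : ℝ → ℝ} {σ : ℝ} (h2 : PotentialHyp pot Q σ) {t : ℝ}
    (ht : 0 < t) (ht1 : t ≤ 1) : 0 < pot t :=
  (h2.nonneg t ⟨ht.le, ht1⟩).lt_of_ne fun h => ht.ne' ((h2.zero_iff t ⟨ht.le, ht1⟩).1 h.symm)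

theorem PotentialHyp.exists_pos_le {pot Q : ℝ → ℝ} {σ : ℝ} (h2 : PotentialHyp pot Q σ) {η : ℝ}
    (hη : 0 < η) : ∃ m > 0, ∀ t ∈ Icc η 1, m ≤ pot t :=
  exists_pos_le_of_continuousOn (h2.cont.mono (Icc_subset_Icc_left hη.le))
    fun _ hx => h2.pos (hη.trans_le hx.1) hx.2

theorem PotentialHyp.exists_mul_le {fhat Q pot : ℝ → ℝ} {σ : ℝ} (hσ : 0 < σ)
    (h1 : DegradationHyp fhat Q) (h2 : PotentialHyp pot Q σ) :
    ∃ c > 0, ∀ t ∈ Icc (0 : ℝ) 1, c * Q t ≤ pot t := by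
  obtain ⟨δ, hδ, hδ'⟩ := mem_nhdsGT_iff_exists_Ioo_subset.1
    (h2.tendsto.eventually (lt_mem_nhds (half_lt_self hσ)))
  have hδ : 0 < δ := hδ
  obtain ⟨m, hm, hm'⟩ := h2.exists_pos_le hδ
  obtain ⟨B, hB⟩ := isCompact_Icc.exists_bound_of_continuousOn h1.Q_cont
  have hB0 : 0 ≤ B := (norm_nonneg _).trans (hB 0 (by simp))
  -- The first bound comes from the limit `σ` near `0`, the second from compactness on `[δ, 1]`.
  refine ⟨min ((σ / 2) ^ 2) (m / (B + 1)), lt_min (by positivity) (by positivity), fun t ht => ?_⟩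
  have hQ := h1.Q_nonneg t ht
  rcases ht.1.eq_or_lt with h | h
  · rw [(h1.Q_zero_iff t ht).2 h.symm, mul_zero]
    exact h2.nonneg t ht
  rcases lt_or_ge t δ with h' | h'
  · have := hδ' ⟨h, h'⟩
    have hQ' : 0 < Q t := hQ.lt_of_ne fun e => h.ne' ((h1.Q_zero_iff t ht).1 e.symm)
    have hs : (σ / 2) ^ 2 ≤ pot t / Q t := (Real.lt_sqrt (by linarith)).1 this |>.le
    rw [le_div_iff₀ hQ'] at hs
    exact (mul_le_mul_of_nonneg_right (min_le_left _ _) hQ).trans hs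
  · have hQB : Q t ≤ B + 1 := by
      have := (le_abs_self _).trans (hB t ht)
      linarith
    calc _ ≤ m / (B + 1) * (B + 1) := mul_le_mul (min_le_right _ _) hQB hQ (by positivity)
      _ = m := by field_simp
      _ ≤ _ := hm' t ⟨h', ht.2⟩

/-- The integrand of the phase-field energy, with phase-field value `t`, displacement gradient `p`
and phase-field gradient `q`. -/
def density (φ fhat Q pot : ℝ → ℝ) (ε t p q : ℝ) : ℝ :=
  coeff φ fhat Q ε t * |p| ^ 2 + pot (1 - t) / (4 * ε) + ε * |q| ^ 2

theorem coeff_nonneg {φ fhat Q : ℝ → ℝ} (h3 : PhiHyp φ) {ε t : ℝ} (hε : 0 < ε) :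
    0 ≤ coeff φ fhat Q ε t := by
  rw [coeff]
  split_ifs
  · exact h3.nonneg _ (by positivity)
  · obtain ⟨L, hL, hL'⟩ := h3.tendsto
    rw [hL'.limUnder_eq]; exact hL.le

theorem one_sub_mem_Icc {t : ℝ} (ht : t ∈ Icc (0 : ℝ) 1) : 1 - t ∈ Icc (0 : ℝ) 1 :=
  ⟨by linarith [ht.2], by linarith [ht.1]⟩

theorem div_le_density {φ fhat Q pot : ℝ → ℝ} (h3 : PhiHyp φ) {ε t p q : ℝ} (hε : 0 < ε) :
    pot (1 - t) / (4 * ε) ≤ density φ fhat Q pot ε t p q := by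
  have h1 : 0 ≤ coeff φ fhat Q ε t * |p| ^ 2 := mul_nonneg (coeff_nonneg h3 hε) (by positivity)
  have h2 : 0 ≤ ε * |q| ^ 2 := by positivity
  rw [density]; linarith

theorem density_nonneg {φ fhat Q pot : ℝ → ℝ} {σ : ℝ} (h2 : PotentialHyp pot Q σ)
    (h3 : PhiHyp φ) {ε t p q : ℝ} (hε : 0 < ε) (ht : t ∈ Icc (0 : ℝ) 1) :
    0 ≤ density φ fhat Q pot ε t p q :=
  (div_nonneg (h2.nonneg _ (one_sub_mem_Icc ht)) (by positivity)).trans (div_le_density h3 hε)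

/-- Away from the fully cracked state `t = 0`, the energy density controls the displacement
gradient, uniformly in `ε`. -/
theorem exists_abs_le_mul_density_of_le {fhat Q pot φ : ℝ → ℝ} {σ : ℝ} (hσ : 0 < σ)
    (h1 : DegradationHyp fhat Q) (h2 : PotentialHyp pot Q σ) (h3 : PhiHyp φ)
    (h4 : PhiZeroHyp φ) {η : ℝ} (hη : 0 < η) :
    ∃ K > 0, ∀ ε > 0, ∀ t ∈ Icc η 1, ∀ p q,
      |p| ≤ K * (density φ fhat Q pot ε t p q + 1) := by
  obtain ⟨c, hc, hφ⟩ := h3.exists_mul_min_le h4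
  obtain ⟨c', hc', hpot⟩ := h2.exists_mul_le hσ h1
  obtain ⟨m, hm, hf⟩ := exists_pos_le_of_continuousOn
    (h1.fhat_cont.mono (Icc_subset_Icc_left hη.le)) fun x hx =>
      (h1.fhat_nonneg x ⟨hη.le.trans hx.1, hx.2⟩).lt_of_ne fun h =>
        (hη.trans_le hx.1).ne' ((h1.fhat_zero_iff x ⟨hη.le.trans hx.1, hx.2⟩).1 h.symm)
  obtain ⟨L, hL, hL'⟩ := h3.tendsto
  -- `r` is a lower bound for all three coefficients that occur below.
  obtain ⟨r, hr, hrc, hrL, hrm⟩ : ∃ r > 0, r ≤ c ∧ r ≤ L ∧ r ^ 2 ≤ c * m * c' := by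
    refine ⟨min (min c L) √(c * m * c'), by positivity, (min_le_left _ _).trans (min_le_left _ _),
      (min_le_left _ _).trans (min_le_right _ _), ?_⟩
    calc _ ≤ √(c * m * c') ^ 2 := by gcongr; exact min_le_right _ _
      _ = _ := Real.sq_sqrt (by positivity)
  refine ⟨1 + 1 / r, by positivity, fun ε hε t ht p q => ?_⟩
  have htI : t ∈ Icc (0 : ℝ) 1 := ⟨hη.le.trans ht.1, ht.2⟩
  have hp2 : 0 ≤ |p| ^ 2 := by positivity
  have hq2 : 0 ≤ ε * |q| ^ 2 := by positivity
  have hpot0 : 0 ≤ pot (1 - t) / (4 * ε) :=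
    div_nonneg (h2.nonneg _ (one_sub_mem_Icc htI)) (by positivity)
  have hD := density_nonneg (p := p) (q := q) (fhat := fhat) h2 h3 hε htI
  -- If the coefficient of `|p|²` is bounded below, then `|p| ≤ |p|² + 1` suffices.
  have hA : r ≤ coeff φ fhat Q ε t → |p| ≤ (1 + 1 / r) * (density φ fhat Q pot ε t p q + 1) := by
    intro hcoeff
    have h5 : r * |p| ^ 2 ≤ density φ fhat Q pot ε t p q := by
      have := mul_le_mul_of_nonneg_right hcoeff hp2
      rw [density]; linarith
    have h6 : |p| ≤ |p| ^ 2 + 1 := by nlinarith [sq_nonneg (|p| - 1)]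
    have h7 : |p| ^ 2 ≤ 1 / r * density φ fhat Q pot ε t p q := by
      rw [one_div, ← div_eq_inv_mul, le_div_iff₀ hr]; linarith
    have : 0 ≤ 1 / r := by positivity
    nlinarith
  rcases lt_or_ge t 1 with ht1 | ht1
  · have hQ : 0 < Q (1 - t) := (h1.Q_nonneg _ (one_sub_mem_Icc htI)).lt_of_ne fun e => by
      have := (h1.Q_zero_iff _ (one_sub_mem_Icc htI)).1 e.symm
      linarith
    have hdeg : degr fhat Q t ^ 2 = fhat t / Q (1 - t) :=
      Real.sq_sqrt (div_nonneg (h1.fhat_nonneg _ htI) hQ.le)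
    have hco : coeff φ fhat Q ε t = φ (ε * (fhat t / Q (1 - t))) := by
      rw [coeff, if_pos ht1, hdeg]
    have hs0 : 0 ≤ ε * (fhat t / Q (1 - t)) := by
      rw [← hdeg]; positivity
    have hφ' := hφ _ hs0
    rcases le_or_gt 1 (ε * (fhat t / Q (1 - t))) with hs | hs
    · apply hA
      rw [hco]
      rw [min_eq_right hs] at hφ'
      linarith
    · rw [min_eq_left hs.le] at hφ'
      -- Now `φ` is bounded below by a linear function, and the first two terms of the density
      -- are of the form `A |p|² / y` and `c' y / 4` for `y = Q (1 - t) / ε`.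
      set y := Q (1 - t) / ε with hy
      have hy0 : 0 < y := by positivity
      have e1 : ε * (fhat t / Q (1 - t)) = fhat t / y := by rw [hy]; field_simp
      have h5 : c * m / y * |p| ^ 2 ≤ coeff φ fhat Q ε t * |p| ^ 2 := by
        refine mul_le_mul_of_nonneg_right ?_ hp2
        rw [hco]
        refine le_trans ?_ hφ'
        rw [e1, mul_div_assoc]
        gcongr
        exact hf t ht
      have h6 : c' * y / 4 ≤ pot (1 - t) / (4 * ε) := by
        have := hpot _ (one_sub_mem_Icc htI)
        calc c' * y / 4 = c' * Q (1 - t) / (4 * ε) := by rw [hy]; field_simp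
          _ ≤ _ := by gcongr
      have h7 : r * |p| ≤ c * m / y * |p| ^ 2 + c' * y / 4 := by
        have e2 : c * m / y * |p| ^ 2 + c' * y / 4 - r * |p|
            = (c * m * |p| ^ 2 + c' * y ^ 2 / 4 - r * |p| * y) / y := by field_simp
        have h8 : 0 ≤ c * m * |p| ^ 2 + c' * y ^ 2 / 4 - r * |p| * y := by
          have h9 : 0 ≤ (c' * y / 2 - r * |p|) ^ 2 := sq_nonneg _
          have h10 : r ^ 2 * |p| ^ 2 ≤ c * m * c' * |p| ^ 2 :=
            mul_le_mul_of_nonneg_right hrm hp2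
          have h11 : 0 ≤ c' * (c * m * |p| ^ 2 + c' * y ^ 2 / 4 - r * |p| * y) := by
            nlinarith
          exact nonneg_of_mul_nonneg_right h11 hc'
        have := div_nonneg h8 hy0.le
        linarith
      have h8 : r * |p| ≤ density φ fhat Q pot ε t p q := by rw [density]; linarith
      have h9 : |p| ≤ 1 / r * density φ fhat Q pot ε t p q := by
        rw [one_div, ← div_eq_inv_mul, le_div_iff₀ hr]; linarith
      have : 0 ≤ 1 / r := by positivity
      nlinarith
  · apply hA
    rw [coeff, if_neg (not_lt.2 ht1), hL'.limUnder_eq]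
    exact hrL

/-- Away from the undamaged state `t = 1`, the energy density controls the phase-field gradient,
uniformly in `ε`. -/
theorem exists_abs_le_mul_density_of_ge {fhat Q pot φ : ℝ → ℝ} {σ : ℝ}
    (h2 : PotentialHyp pot Q σ) (h3 : PhiHyp φ) {η : ℝ} (hη : η < 1) :
    ∃ K > 0, ∀ ε > 0, ∀ t ∈ Icc 0 η, ∀ p q,
      |q| ≤ K * density φ fhat Q pot ε t p q := by
  obtain ⟨m, hm, hpot⟩ := h2.exists_pos_le (sub_pos.2 hη)
  refine ⟨1 / √m, by positivity, fun ε hε t ht p q => ?_⟩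
  rw [one_div, ← div_eq_inv_mul, le_div_iff₀ (by positivity)]
  have h1 : 0 ≤ coeff φ fhat Q ε t * |p| ^ 2 := mul_nonneg (coeff_nonneg h3 hε) (by positivity)
  have h5 : m / (4 * ε) ≤ pot (1 - t) / (4 * ε) := by
    gcongr
    exact hpot _ ⟨by linarith [ht.2], by linarith [ht.1]⟩
  have h6 : |q| * √m ≤ m / (4 * ε) + ε * |q| ^ 2 := by
    have e : m / (4 * ε) + ε * |q| ^ 2 - |q| * √m = (√m - 2 * ε * |q|) ^ 2 / (4 * ε) := by
      have := Real.sq_sqrt hm.le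
      field_simp
      nlinarith
    have : 0 ≤ (√m - 2 * ε * |q|) ^ 2 / (4 * ε) := by positivity
    linarith
  rw [density]; linarith

/-! ### Estimates along the family -/

theorem _root_.AbsolutelyContinuousOnInterval.lipschitz_comp {a b : ℝ} {U T : ℝ → ℝ}
    (hU : AbsolutelyContinuousOnInterval U a b) (hT : LipschitzWith 1 T) :
    AbsolutelyContinuousOnInterval (fun x => T (U x)) a b := by
  refine squeeze_zero (fun t => Finset.sum_nonneg fun i _ => dist_nonneg)
    (fun t => Finset.sum_le_sum fun i _ => ?_) hU
  simpa using hT.dist_le_mul (U (t.2 i).1) (U (t.2 i).2)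

/-- A cutoff of the phase field: the function with slope `1` on `[1/4, 1/2]` that vanishes for
`t ≤ 1/4` and is constant, equal to `1/4`, for `t ≥ 1/2`. -/
def cutoff (t : ℝ) : ℝ := max 0 (min (t - 1 / 4) (1 / 4))

theorem lipschitzWith_cutoff : LipschitzWith 1 cutoff := by
  have h : LipschitzWith 1 fun t : ℝ => t - 1 / 4 :=
    LipschitzWith.of_dist_le_mul fun x y => by simp
  exact (h.min_const _).const_max _

theorem cutoff_nonneg (t : ℝ) : 0 ≤ cutoff t := le_max_left _ _

theorem cutoff_le (t : ℝ) : cutoff t ≤ 1 / 4 := max_le (by norm_num) (min_le_right _ _)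

theorem cutoff_of_le {t : ℝ} (ht : t ≤ 1 / 4) : cutoff t = 0 :=
  max_eq_left ((min_le_left _ _).trans (by linarith))

theorem cutoff_of_ge {t : ℝ} (ht : 1 / 2 ≤ t) : cutoff t = 1 / 4 := by
  rw [cutoff, min_eq_right (by linarith), max_eq_right (by norm_num)]

/-- Comparison of increments passes to derivatives. -/
theorem abs_hasDerivAt_le {z g h : ℝ → ℝ} {x z' g' h' A B : ℝ} (hz : HasDerivAt z z' x)
    (hg : HasDerivAt g g' x) (hh : HasDerivAt h h' x)
    (hle : ∀ᶠ y in 𝓝 x, |z y - z x| ≤ A * |g y - g x| + B * |h y - h x|) :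
    |z'| ≤ A * |g'| + B * |h'| := by
  rw [hasDerivAt_iff_tendsto_slope] at hz hg hh
  refine le_of_tendsto_of_tendsto hz.abs ((hg.abs.const_mul A).add (hh.abs.const_mul B)) ?_
  filter_upwards [hle.filter_mono nhdsWithin_le_nhds, self_mem_nhdsWithin] with y hy hne
  have hpos : 0 < |y - x| := abs_pos.2 (sub_ne_zero.2 hne)
  simp only [slope_def_field, abs_div]
  rw [← mul_div_assoc, ← mul_div_assoc, ← add_div]
  gcongr

/-- The derivative of `cutoff(V) T(U)` only sees `U'` where `V ≥ 1/4` and `V'` where `V ≤ 1/2`. -/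
theorem abs_deriv_cutoff_mul_le {U V T : ℝ → ℝ} {x p q M B : ℝ} (hU : HasDerivAt U p x)
    (hV : HasDerivAt V q x) (hT : LipschitzWith 1 T) (hM : ∀ y, |T y| ≤ M)
    (hp : 1 / 4 ≤ V x → |p| ≤ B) (hq : V x ≤ 1 / 2 → |q| ≤ B) :
    |deriv (fun y => cutoff (V y) * T (U y)) x| ≤ (1 + M) * B := by
  have hM0 : 0 ≤ M := (abs_nonneg _).trans (hM 0)
  have hB0 : 0 ≤ B := by
    rcases le_total (V x) (1 / 2) with h | h
    · exact (abs_nonneg _).trans (hq h)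
    · exact (abs_nonneg _).trans (hp (by linarith))
  have hMB : 0 ≤ M * B := mul_nonneg hM0 hB0
  -- Where the product is not differentiable, `deriv` is zero by convention.
  by_cases hd : DifferentiableAt ℝ (fun y => cutoff (V y) * T (U y)) x
  swap
  · rw [deriv_zero_of_not_differentiableAt hd, abs_zero]; positivity
  have hTU : ∀ y, |T (U y) - T (U x)| ≤ |U y - U x| := fun y => by
    simpa [Real.dist_eq] using hT.dist_le_mul (U y) (U x)
  have hcV : ∀ y, |cutoff (V y) - cutoff (V x)| ≤ |V y - V x| := fun y => by
    simpa [Real.dist_eq] using lipschitzWith_cutoff.dist_le_mul (V y) (V x)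
  rcases lt_or_ge (V x) (1 / 4) with h1 | h1
  · have := abs_hasDerivAt_le (A := 0) (B := 0) hd.hasDerivAt hU hV (by
      filter_upwards [hV.continuousAt.eventually (gt_mem_nhds h1)] with y hy
      simp [cutoff_of_le hy.le, cutoff_of_le h1.le])
    refine this.trans ?_
    simp only [zero_mul, add_zero]
    positivity
  rcases lt_or_ge (1 / 2) (V x) with h2 | h2
  · have := abs_hasDerivAt_le (A := 1) (B := 0) hd.hasDerivAt hU hV (by
      filter_upwards [hV.continuousAt.eventually (lt_mem_nhds h2)] with y hy
      rw [cutoff_of_ge hy.le, cutoff_of_ge h2.le, ← mul_sub, abs_mul,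
        abs_of_pos (by norm_num : (0 : ℝ) < 1 / 4)]
      have := hTU y
      have := abs_nonneg (U y - U x)
      linarith)
    linarith [hp h1]
  · have := abs_hasDerivAt_le (A := 1) (B := M) hd.hasDerivAt hU hV (by
      refine Eventually.of_forall fun y => ?_
      have e : cutoff (V y) * T (U y) - cutoff (V x) * T (U x)
          = cutoff (V y) * (T (U y) - T (U x)) + T (U x) * (cutoff (V y) - cutoff (V x)) := by ring
      rw [e]
      refine (abs_add_le _ _).trans ?_
      rw [abs_mul, abs_mul, abs_of_nonneg (cutoff_nonneg _)]
      have h5 := cutoff_le (V y)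
      exact add_le_add (mul_le_mul (h5.trans (by norm_num)) (hTU y) (abs_nonneg _) zero_le_one)
        (mul_le_mul (hM _) (hcV y) (abs_nonneg _) hM0))
    have := mul_le_mul_of_nonneg_left (hq h2) hM0
    linarith [hp h1]

theorem energy_lt_top {φ fhat Q pot : ℝ → ℝ} {Ω A : Set ℝ} {ε : ℝ} {u v : ℝ → ℝ}
    (h : energy φ fhat Q pot Ω ε u v A < ∞) :
    MemH1 Ω u ∧ MemH1 Ω v ∧ (∀ᵐ x ∂volume.restrict Ω, v x ∈ Icc (0 : ℝ) 1) ∧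
      energy φ fhat Q pot Ω ε u v A = ∫⁻ x in A, ENNReal.ofReal
        (density φ fhat Q pot ε (v x) (weakDeriv Ω u x) (weakDeriv Ω v x)) := by
  by_cases hc : MemH1 Ω u ∧ MemH1 Ω v ∧ ∀ᵐ x ∂volume.restrict Ω, v x ∈ Icc (0 : ℝ) 1
  · exact ⟨hc.1, hc.2.1, hc.2.2, by rw [energy, if_pos hc]; rfl⟩
  · rw [energy, if_neg hc] at h
    exact absurd h (lt_irrefl _)

/-- Uniform `W^{1,1}` bound for `cutoff(v) T(u)` in terms of the energy, for every bounded
`1`-Lipschitz function `T`. -/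
theorem exists_integral_abs_deriv_cutoff_mul_le {a b : ℝ} (hab : a < b)
    {fhat Q pot φ : ℝ → ℝ} {σ : ℝ} (hσ : 0 < σ) (h1 : DegradationHyp fhat Q)
    (h2 : PotentialHyp pot Q σ) (h3 : PhiHyp φ) (h4 : PhiZeroHyp φ) :
    ∃ K > 0, ∀ ε > 0, ∀ (C : ℝ) (u v T : ℝ → ℝ) (M : ℝ), 0 ≤ C →
      energy φ fhat Q pot (Ioo a b) ε u v (Ioo a b) ≤ ENNReal.ofReal C →
      LipschitzWith 1 T → (∀ y, |T y| ≤ M) →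
      ∃ z : ℝ → ℝ, AbsolutelyContinuousOnInterval z a b ∧ (∀ x, |z x| ≤ M) ∧
        (∀ᵐ x ∂volume.restrict (Ioo a b), cutoff (v x) * T (u x) = z x) ∧
        ∫ x in a..b, |deriv z x| ≤ (1 + M) * K * (C + (b - a)) := by
  obtain ⟨K₁, hK₁, hK₁'⟩ := exists_abs_le_mul_density_of_le hσ h1 h2 h3 h4
    (by norm_num : (0 : ℝ) < 1 / 4)
  obtain ⟨K₂, hK₂, hK₂'⟩ := exists_abs_le_mul_density_of_ge (fhat := fhat) h2 h3
    (by norm_num : (1 / 2 : ℝ) < 1)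
  refine ⟨K₁ + K₂, by positivity, fun ε hε C u v T M hC0 hC hT hM => ?_⟩
  obtain ⟨hu, hv, hv01, hE⟩ := energy_lt_top (hC.trans_lt ENNReal.ofReal_lt_top)
  obtain ⟨U, hU, huU, hU'⟩ := hu.exists_absolutelyContinuous hab
  obtain ⟨V, hV, hvV, hV'⟩ := hv.exists_absolutelyContinuous hab
  have hM0 : 0 ≤ M := (abs_nonneg _).trans (hM 0)
  have hz : AbsolutelyContinuousOnInterval (fun x => cutoff (V x) * T (U x)) a b :=
    (hV.lipschitz_comp lipschitzWith_cutoff).fun_mul (hU.lipschitz_comp hT)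
  refine ⟨fun x => cutoff (V x) * T (U x), hz, fun x => ?_, ?_, ?_⟩
  · rw [abs_mul, abs_of_nonneg (cutoff_nonneg _)]
    have := cutoff_le (V x)
    have := mul_le_mul (this.trans (by norm_num : (1 / 4 : ℝ) ≤ 1)) (hM (U x)) (abs_nonneg _)
      zero_le_one
    linarith
  · filter_upwards [huU, hvV] with x hx hx'
    rw [hx, hx']
  · have hpt : ∀ᵐ x ∂volume.restrict (Ioo a b),
        ENNReal.ofReal |deriv (fun x => cutoff (V x) * T (U x)) x| ≤
          ENNReal.ofReal ((1 + M) * (K₁ + K₂)) * (ENNReal.ofReal (density φ fhat Q pot ε (v x)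
            (weakDeriv (Ioo a b) u x) (weakDeriv (Ioo a b) v x)) + 1) := by
      filter_upwards [hvV, hU', hV', hv01] with x hx hUx hVx h01
      set D := density φ fhat Q pot ε (v x) (weakDeriv (Ioo a b) u x) (weakDeriv (Ioo a b) v x)
        with hDdef
      have hD : 0 ≤ D := density_nonneg h2 h3 hε h01
      have hb := abs_deriv_cutoff_mul_le (B := (K₁ + K₂) * (D + 1)) hUx hVx hT hM
        (fun h => by
          rw [← hx] at h
          have := hK₁' ε hε (v x) ⟨h, h01.2⟩ (weakDeriv (Ioo a b) u x) (weakDeriv (Ioo a b) v x)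
          rw [← hDdef] at this
          nlinarith)
        (fun h => by
          rw [← hx] at h
          have := hK₂' ε hε (v x) ⟨h01.1, h⟩ (weakDeriv (Ioo a b) u x) (weakDeriv (Ioo a b) v x)
          rw [← hDdef] at this
          nlinarith)
      rw [← mul_assoc] at hb
      calc _ ≤ ENNReal.ofReal ((1 + M) * (K₁ + K₂) * (D + 1)) := ENNReal.ofReal_le_ofReal hb
        _ = _ := by
          rw [ENNReal.ofReal_mul (by positivity), ENNReal.ofReal_add hD zero_le_one,
            ENNReal.ofReal_one]
    have hint : IntegrableOn (fun x => |deriv (fun x => cutoff (V x) * T (U x)) x|) (Ioo a b) :=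
      ((intervalIntegrable_iff_integrableOn_Ioo_of_le hab.le).1 hz.intervalIntegrable_deriv).abs
    have hRHS : 0 ≤ (1 + M) * (K₁ + K₂) * (C + (b - a)) := by
      have := sub_pos.2 hab
      positivity
    rw [intervalIntegral.integral_of_le hab.le, integral_Ioc_eq_integral_Ioo,
      ← ENNReal.ofReal_le_ofReal_iff hRHS,
      ofReal_integral_eq_lintegral_ofReal hint (ae_of_all _ fun _ => abs_nonneg _)]
    refine (lintegral_mono_ae hpt).trans ?_
    rw [lintegral_const_mul' _ _ ENNReal.ofReal_ne_top, lintegral_add_right _ measurable_const,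
      ← hE,
      ENNReal.ofReal_mul (p := (1 + M) * (K₁ + K₂)) (by positivity),
      ENNReal.ofReal_add hC0 (sub_pos.2 hab).le]
    gcongr
    simp

/-- Along a sequence with `ε → 0` and bounded energies, the phase fields converge to `1` in
measure. -/
theorem tendstoInMeasure_of_energy_le {a b : ℝ}
    {fhat Q pot φ : ℝ → ℝ} {σ : ℝ} (h2 : PotentialHyp pot Q σ) (h3 : PhiHyp φ)
    {ε : ℕ → ℝ} (hε : ∀ j, 0 < ε j) (hε0 : Tendsto ε atTop (𝓝 0)) {u v : ℕ → ℝ → ℝ} {C : ℝ≥0∞}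
    (hC : C < ∞) (hE : ∀ j, energy φ fhat Q pot (Ioo a b) (ε j) (u j) (v j) (Ioo a b) ≤ C)
    (hv : ∀ j, AEStronglyMeasurable (v j) (volume.restrict (Ioo a b))) :
    TendstoInMeasure (volume.restrict (Ioo a b)) v atTop fun _ => 1 := by
  rw [tendstoInMeasure_iff_dist]
  intro η hη
  obtain ⟨m, hm, hpot⟩ := h2.exists_pos_le hη
  have hlim : Tendsto (fun j => ENNReal.ofReal (4 * ε j / m) * C) atTop (𝓝 0) := by
    have h1 : Tendsto (fun j => 4 * ε j / m) atTop (𝓝 0) := by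
      simpa using (hε0.const_mul 4).div_const m
    have h2 := ENNReal.Tendsto.mul_const (ENNReal.tendsto_ofReal h1) (Or.inr hC.ne) (b := C)
    simpa using h2
  refine tendsto_of_tendsto_of_tendsto_of_le_of_le tendsto_const_nhds hlim
    (fun _ => zero_le) fun j => ?_
  obtain ⟨-, -, hv01, hEj⟩ := energy_lt_top ((hE j).trans_lt hC)
  have hEC := hE j
  rw [hEj] at hEC
  set S := {x | η ≤ dist (v j x) 1} with hS
  have hSm : NullMeasurableSet S (volume.restrict (Ioo a b)) :=
    nullMeasurableSet_le aemeasurable_const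
      ((hv j).aemeasurable.dist aemeasurable_const)
  have hpos : 0 < m / (4 * ε j) := div_pos hm (mul_pos four_pos (hε j))
  have h5 : ENNReal.ofReal (m / (4 * ε j)) * volume.restrict (Ioo a b) S ≤ C := by
    rw [← lintegral_indicator_const₀ hSm]
    refine le_trans (lintegral_mono_ae ?_) hEC
    filter_upwards [hv01] with x hx
    by_cases hxS : x ∈ S
    · rw [indicator_of_mem hxS]
      refine ENNReal.ofReal_le_ofReal (le_trans ?_ (div_le_density h3 (hε j)))
      have := hε j
      gcongr
      have hx1 : η ≤ |v j x - 1| := hxS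
      rw [abs_sub_comm, abs_of_nonneg (by linarith [hx.2])] at hx1
      exact hpot _ ⟨hx1, by linarith [hx.1]⟩
    · rw [indicator_of_notMem hxS]; exact zero_le
  calc volume.restrict (Ioo a b) S
      = ENNReal.ofReal (4 * ε j / m) *
          (ENNReal.ofReal (m / (4 * ε j)) * volume.restrict (Ioo a b) S) := by
        have := hε j
        rw [← mul_assoc, ← ENNReal.ofReal_mul (by positivity)]
        have e : 4 * ε j / m * (m / (4 * ε j)) = 1 := by field_simp
        rw [e, ENNReal.ofReal_one, one_mul]
    _ ≤ _ := by gcongr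

/-! ### Limits of bounded sequences -/

theorem lipschitzWith_arctan : LipschitzWith 1 Real.arctan :=
  lipschitzWith_of_nnnorm_deriv_le Real.differentiable_arctan fun x => by
    rw [← NNReal.coe_le_coe, coe_nnnorm, Real.deriv_arctan, Real.norm_eq_abs,
      abs_of_pos (by positivity), NNReal.coe_one, div_le_one (by positivity)]
    nlinarith [sq_nonneg x]

theorem abs_arctan_le (x : ℝ) : |Real.arctan x| ≤ Real.pi / 2 :=
  abs_le.2 ⟨(Real.neg_pi_div_two_lt_arctan x).le, (Real.arctan_lt_pi_div_two x).le⟩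

theorem lipschitzWith_clamp (M : ℝ) : LipschitzWith 1 fun y : ℝ => max (min y M) (-M) :=
  (LipschitzWith.id.min_const M).max_const (-M)

theorem abs_clamp_le {M : ℝ} (hM : 0 ≤ M) (y : ℝ) : |max (min y M) (-M)| ≤ M :=
  abs_le.2 ⟨le_max_right _ _, max_le (min_le_right _ _) (by linarith)⟩

/-- If `arctan (y j)` converges and `y` does not escape to infinity, then `y` converges. -/
theorem exists_tendsto_of_tendsto_arctan {y : ℕ → ℝ} {w : ℝ}
    (hw : Tendsto (fun j => Real.arctan (y j)) atTop (𝓝 w))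
    (hy : liminf (fun j => ‖y j‖ₑ) atTop ≠ ∞) : ∃ l, Tendsto y atTop (𝓝 l) := by
  obtain ⟨R, hR⟩ := ENNReal.lt_iff_exists_nnreal_btwn.1 (lt_top_iff_ne_top.2 hy)
  have hfreq : ∃ᶠ j in atTop, y j ∈ Icc (-(R : ℝ)) R := by
    refine (frequently_lt_of_liminf_lt (h := hR.1)).mono fun j hj => ?_
    have : ‖y j‖₊ < R := by exact_mod_cast hj
    have : ‖y j‖ < R := by exact_mod_cast this
    exact abs_le.1 this.le
  obtain ⟨l, -, k, hk, hl⟩ := isCompact_Icc.tendsto_subseq' hfreq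
  have hwl : w = Real.arctan l :=
    tendsto_nhds_unique (hw.comp hk.tendsto_atTop) ((Real.continuous_arctan.tendsto l).comp hl)
  have hcont : ContinuousAt Real.tan w :=
    Real.continuousAt_tan.2 (hwl ▸ (Real.cos_arctan_pos l).ne')
  refine ⟨Real.tan w, (hcont.tendsto.comp hw).congr fun j => ?_⟩
  simp

/-- Fatou's lemma: a sequence bounded in `L¹` does not escape to infinity pointwise. -/
theorem ae_liminf_enorm_ne_top {α : Type*} [MeasurableSpace α] {μ : Measure α} {f : ℕ → α → ℝ}
    {C : ℝ≥0∞} (hC : C < ∞) (hf : ∀ n, AEStronglyMeasurable (f n) μ)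
    (hb : ∀ n, eLpNorm (f n) 1 μ ≤ C) :
    ∀ᵐ x ∂μ, liminf (fun n => ‖f n x‖ₑ) atTop ≠ ∞ := by
  have h1 : ∫⁻ x, liminf (fun n => ‖f n x‖ₑ) atTop ∂μ ≤ C := by
    refine (lintegral_liminf_le' fun n => (hf n).enorm).trans ?_
    refine liminf_le_of_frequently_le' (Frequently.of_forall fun n => ?_)
    rw [← eLpNorm_one_eq_lintegral_enorm]; exact hb n
  have hm : AEMeasurable (fun x => liminf (fun n => ‖f n x‖ₑ) atTop) μ := by
    refine ⟨_, Measurable.liminf fun n => (hf n).stronglyMeasurable_mk.enorm, ?_⟩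
    filter_upwards [ae_all_iff.2 fun n => (hf n).ae_eq_mk] with x hx
    simp only [hx]
  filter_upwards [ae_lt_top' hm (h1.trans_lt hC).ne] with x hx using hx.ne

/-- Lower semicontinuity of the variation along a bounded sequence that is bounded in `W^{1,1}` and
converges almost everywhere. -/
theorem memBV_of_tendsto {a b M B : ℝ} (hab : a < b) {z : ℕ → ℝ → ℝ} {w : ℝ → ℝ}
    (hz : ∀ n, AbsolutelyContinuousOnInterval (z n) a b) (hM : ∀ n x, |z n x| ≤ M)
    (hB : ∀ n, ∫ x in a..b, |deriv (z n) x| ≤ B)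
    (hw : ∀ᵐ x ∂volume.restrict (Ioo a b), Tendsto (fun n => z n x) atTop (𝓝 (w x))) :
    MemBV (Ioo a b) w := by
  have hzm : ∀ n, AEStronglyMeasurable (z n) (volume.restrict (Ioo a b)) := fun n => by
    have := (hz n).continuousOn
    rw [uIcc_of_le hab.le] at this
    exact (this.mono Ioo_subset_Icc_self).aestronglyMeasurable measurableSet_Ioo
  have hwm := aestronglyMeasurable_of_tendsto_ae atTop hzm hw
  have hwM : ∀ᵐ x ∂volume.restrict (Ioo a b), ‖w x‖ ≤ M := by
    filter_upwards [hw] with x hx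
    exact le_of_tendsto hx.norm (Eventually.of_forall fun n => hM n x)
  refine ⟨Integrable.of_bound hwm M hwM, B, ?_⟩
  rintro r ⟨ψ, hψ, hψ1, rfl⟩
  have hc : Continuous (deriv ψ) := hψ.1.continuous_deriv (by simp)
  obtain ⟨D, hD⟩ := hψ.2.1.deriv.exists_bound_of_continuous hc
  have hM0 : 0 ≤ M := (abs_nonneg _).trans (hM 0 0)
  have hlim : Tendsto (fun n => ∫ x in Ioo a b, z n x * deriv ψ x) atTop
      (𝓝 (∫ x in Ioo a b, w x * deriv ψ x)) := by
    refine tendsto_integral_of_dominated_convergence (fun _ => M * D)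
      (fun n => (hzm n).mul hc.aestronglyMeasurable) (integrable_const _)
      (fun n => ae_of_all _ fun x => ?_) ?_
    · rw [norm_mul]
      exact mul_le_mul (hM n x) (hD x) (norm_nonneg _) hM0
    · filter_upwards [hw] with x hx using hx.mul_const _
  refine le_of_tendsto hlim (Eventually.of_forall fun n => ?_)
  rw [integral_mul_deriv_test hab (hz n) hψ]
  refine le_trans ?_ (hB n)
  rw [intervalIntegral.integral_of_le hab.le, integral_Ioc_eq_integral_Ioo]
  have hint : IntegrableOn (deriv (z n)) (Ioo a b) :=
    (intervalIntegrable_iff_integrableOn_Ioo_of_le hab.le).1 (hz n).intervalIntegrable_deriv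
  refine (neg_le_abs _).trans ((abs_integral_le_integral_abs).trans ?_)
  refine integral_mono_of_nonneg (ae_of_all _ fun _ => abs_nonneg _) hint.abs
    (ae_of_all _ fun x => ?_)
  simp only [abs_mul]
  exact mul_le_of_le_one_right (abs_nonneg _) (hψ1 x)

theorem MemBV.congr_ae {Ω : Set ℝ} {u w : ℝ → ℝ} (h : MemBV Ω u)
    (huw : ∀ᵐ x ∂volume.restrict Ω, u x = w x) : MemBV Ω w := by
  refine ⟨Integrable.congr h.1 huw, ?_⟩
  obtain ⟨B, hB⟩ := h.2
  refine ⟨B, ?_⟩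
  rintro r ⟨ψ, hψ, hψ1, rfl⟩
  refine hB ⟨ψ, hψ, hψ1, integral_congr_ae (huw.mono fun x hx => ?_)⟩
  simp only [hx]

theorem MemBV.const_mul {Ω : Set ℝ} {u : ℝ → ℝ} (h : MemBV Ω u) {c : ℝ} (hc : 0 ≤ c) :
    MemBV Ω fun x => c * u x := by
  obtain ⟨B, hB⟩ := h.2
  refine ⟨h.1.const_mul c, c * B, ?_⟩
  rintro r ⟨ψ, hψ, hψ1, rfl⟩
  simp_rw [mul_assoc]
  rw [integral_const_mul]
  exact mul_le_mul_of_nonneg_left (hB ⟨ψ, hψ, hψ1, rfl⟩) hc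

end PhaseField

end

/-! ### Compactness -/

theorem theorem3p1 (a b : ℝ) (hab : a < b) (φ fhat Q pot : ℝ → ℝ) (σ : ℝ) (hσ : 0 < σ)
    (h1 : PhaseField.DegradationHyp fhat Q) (h2 : PhaseField.PotentialHyp pot Q σ)
    (h3 : PhaseField.PhiHyp φ) (h4 : PhaseField.PhiZeroHyp φ)
    (u v : ℝ → ℝ → ℝ)
    (hu : ∀ ε : ℝ, 0 < ε → IntegrableOn (u ε) (Ioo a b))
    (hv : ∀ ε : ℝ, 0 < ε → IntegrableOn (v ε) (Ioo a b))
    (hbound : (⨆ ε : Ioi (0 : ℝ),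
      (PhaseField.energy φ fhat Q pot (Ioo a b) ε (u ε) (v ε) (Ioo a b)
        + eLpNorm (u ε) 1 (volume.restrict (Ioo a b)))) < ∞)
    (e : ℕ → ℝ) (he : ∀ j, 0 < e j) (he0 : Tendsto e atTop (𝓝 0)) :
    ∃ (k : ℕ → ℕ) (u₀ : ℝ → ℝ), StrictMono k ∧
      IntegrableOn u₀ (Ioo a b) ∧ PhaseField.MemGBV (Ioo a b) u₀ ∧
      (∀ᵐ x ∂volume.restrict (Ioo a b),
        Tendsto (fun j => u (e (k j)) x) atTop (𝓝 (u₀ x)) ∧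
        Tendsto (fun j => v (e (k j)) x) atTop (𝓝 1)) ∧
      (UnifIntegrable (fun ε : Ioi (0 : ℝ) => u ε) 1 (volume.restrict (Ioo a b)) →
        Tendsto (fun j => eLpNorm (u (e (k j)) - u₀) 1 (volume.restrict (Ioo a b)))
          atTop (𝓝 0)) := by
  open PhaseField in
  set C : ℝ≥0∞ := ⨆ ε : Ioi (0 : ℝ),
      (energy φ fhat Q pot (Ioo a b) ε (u ε) (v ε) (Ioo a b)
        + eLpNorm (u ε) 1 (volume.restrict (Ioo a b))) with hC
  have hle : ∀ ε : ℝ, 0 < ε → energy φ fhat Q pot (Ioo a b) ε (u ε) (v ε) (Ioo a b)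
        + eLpNorm (u ε) 1 (volume.restrict (Ioo a b)) ≤ C := fun ε hε =>
    le_iSup (fun ε : Ioi (0 : ℝ) => energy φ fhat Q pot (Ioo a b) ε (u ε) (v ε) (Ioo a b)
        + eLpNorm (u ε) 1 (volume.restrict (Ioo a b))) ⟨ε, hε⟩
  have hE : ∀ ε : ℝ, 0 < ε → energy φ fhat Q pot (Ioo a b) ε (u ε) (v ε) (Ioo a b) ≤ C :=
    fun ε hε => le_self_add.trans (hle ε hε)
  have hN : ∀ ε : ℝ, 0 < ε → eLpNorm (u ε) 1 (volume.restrict (Ioo a b)) ≤ C :=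
    fun ε hε => le_add_self.trans (hle ε hε)
  obtain ⟨K, -, hKz⟩ := exists_integral_abs_deriv_cutoff_mul_le hab hσ h1 h2 h3 h4
  have hKz' : ∀ (T : ℝ → ℝ) (M : ℝ), LipschitzWith 1 T → (∀ y, |T y| ≤ M) → ∀ ε : ℝ, 0 < ε →
      ∃ z : ℝ → ℝ, AbsolutelyContinuousOnInterval z a b ∧ (∀ x, |z x| ≤ M) ∧
        (∀ᵐ x ∂volume.restrict (Ioo a b), cutoff (v ε x) * T (u ε x) = z x) ∧
        ∫ x in a..b, |deriv z x| ≤ (1 + M) * K * (C.toReal + (b - a)) := fun T M hT hM ε hε =>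
    hKz ε hε C.toReal (u ε) (v ε) T M ENNReal.toReal_nonneg
      ((hE ε hε).trans_eq (ENNReal.ofReal_toReal hbound.ne).symm) hT hM
  obtain ⟨k₁, hk₁, hv₁⟩ := (tendstoInMeasure_of_energy_le h2 h3 he he0 hbound
    (fun j => hE _ (he j)) fun j => (hv _ (he j)).aestronglyMeasurable).exists_seq_tendsto_ae
  choose z hzAC hzM hzae hzB using fun j =>
    hKz' Real.arctan (Real.pi / 2) lipschitzWith_arctan abs_arctan_le (e (k₁ j)) (he _)
  obtain ⟨k₂, hk₂, hz₂⟩ := exists_subseq_tendsto_of_integral_abs_deriv_le hab hzAC hzM hzB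
  set k := k₁ ∘ k₂ with hk
  have hvk : ∀ᵐ x ∂volume.restrict (Ioo a b),
      Tendsto (fun j => v (e (k j)) x) atTop (𝓝 1) := by
    filter_upwards [hv₁] with x hx using hx.comp hk₂.tendsto_atTop
  -- The cutoff of the phase field is eventually `1/4`, so it can be divided out.
  have hcut : ∀ᵐ x ∂volume.restrict (Ioo a b),
      ∀ᶠ j in atTop, cutoff (v (e (k j)) x) = 1 / 4 := by
    filter_upwards [hvk] with x hx
    filter_upwards [hx.eventually (lt_mem_nhds (by norm_num : (1 / 2 : ℝ) < 1))] with j hj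
    exact cutoff_of_ge hj.le
  have hum : ∀ j, AEStronglyMeasurable (u (e (k j))) (volume.restrict (Ioo a b)) :=
    fun j => (hu _ (he _)).aestronglyMeasurable
  have hconv : ∀ᵐ x ∂volume.restrict (Ioo a b), ∃ l,
      Tendsto (fun j => u (e (k j)) x) atTop (𝓝 l) := by
    filter_upwards [hcut, hz₂, ae_all_iff.2 hzae,
      ae_liminf_enorm_ne_top hbound hum fun j => hN _ (he _)] with x hc ⟨l, hl⟩ hzx hfin
    refine exists_tendsto_of_tendsto_arctan (w := 4 * l) ((hl.const_mul 4).congr' ?_) hfin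
    filter_upwards [hc] with j hj
    have := hzx (k₂ j)
    rw [← this]
    simp only [hk, Function.comp_apply] at hj ⊢
    rw [hj]; ring
  obtain ⟨u₀, hu₀m, hu₀⟩ := measurable_limit_of_tendsto_metrizable_ae
    (fun j => (hum j).aemeasurable) hconv
  have hu₀s : AEStronglyMeasurable u₀ (volume.restrict (Ioo a b)) := hu₀m.aestronglyMeasurable
  have hu₀I : MemLp u₀ 1 (volume.restrict (Ioo a b)) := by
    refine ⟨hu₀s, (Lp.eLpNorm_lim_le_liminf_eLpNorm hum u₀ hu₀).trans_lt ?_⟩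
    exact (liminf_le_of_frequently_le' (Frequently.of_forall fun j => hN _ (he _))).trans_lt hbound
  refine ⟨k, u₀, hk₁.comp hk₂, memLp_one_iff_integrable.1 hu₀I, ⟨hu₀s, fun M hM => ?_⟩, ?_, ?_⟩
  · choose y hyAC hyM hyae hyB using fun j =>
      hKz' _ M (lipschitzWith_clamp M) (abs_clamp_le hM.le) (e (k j)) (he _)
    have hBV : MemBV (Ioo a b) fun x => 1 / 4 * trunc M u₀ x := by
      refine memBV_of_tendsto hab hyAC hyM hyB ?_
      filter_upwards [hcut, hu₀, ae_all_iff.2 hyae] with x hc hx hyx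
      have hT := ((lipschitzWith_clamp M).continuous.tendsto (u₀ x)).comp hx
      refine (hT.const_mul (1 / 4)).congr' ?_
      filter_upwards [hc] with j hj
      rw [← hyx j, hj]; rfl
    refine (hBV.const_mul (by norm_num : (0 : ℝ) ≤ 4)).congr_ae (ae_of_all _ fun x => ?_)
    ring
  · filter_upwards [hu₀, hvk] with x hx hx' using ⟨hx, hx'⟩
  · intro hUI
    refine tendsto_Lp_finite_of_tendsto_ae le_rfl ENNReal.one_ne_top hum hu₀I ?_ hu₀
    intro ε hε
    obtain ⟨δ, hδ, h⟩ := hUI hε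
    exact ⟨δ, hδ, fun j => h ⟨e (k j), he _⟩⟩
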